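/- Let $n\ge 1$, let $B_n$ be the braid group on $n$ strands, and let $H_1,\dots,H_{n-1}$ be frame generators of $B_n$; that is, $H_1,\dots,H_{n-1}$ generate $B_n$ and $$H_iH_j=H_jH_i\quad(|i-j|>1),\qquad H_iH_jH_i=H_jH_iH_j\quad(|i-j|=1)$$ is a complete list of relations between them. Let $p\ge 0$ and $i_1,\dots,i_p,\,j_1,\dots,j_p\in\{1,\dots,n-1\}$ be such that $$H_{i_1}H_{i_2}\cdots H_{i_p}=H_{j_1}H_{j_2}\cdots H_{j_p}\quad\text{in } B_n .$$ Then the factorizations $(H_{i_1},\dots,H_{i_p})$ and $(H_{j_1},\dots,H_{j_p})$ are Hurwitz equivalent: one is obtained from the other by a finite sequence of Hurwitz moves $R_k^{\pm1}$, $1\le k<p$. Here, for a group $G$, the move $R_k$ replaces $(t_1,\dots,t_p)\in G^p$ by $$(t_1,\dots,t_{k-1},\;t_kt_{k+1}t_k^{-1},\;t_k,\;t_{k+2},\dots,t_p),$$ and $R_k^{-1}$ is the inverse of this move. -/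

import Mathlib

/-- Artin's relators of the braid group on `n` strands, in the free group on the `n - 1` letters
`0, …, n - 2`: the commutative relation for `|i - j| > 1` and the triple relation for
`|i - j| = 1`. -/
def braidRelators (n : ℕ) : Set (FreeGroup (Fin (n - 1))) :=
  {r | ∃ i j : Fin (n - 1), 1 < |(i : ℤ) - (j : ℤ)| ∧
      r = (FreeGroup.of i * FreeGroup.of j) * (FreeGroup.of j * FreeGroup.of i)⁻¹} ∪
  {r | ∃ i j : Fin (n - 1), |(i : ℤ) - (j : ℤ)| = 1 ∧
      r = (FreeGroup.of i * FreeGroup.of j * FreeGroup.of i) *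
        (FreeGroup.of j * FreeGroup.of i * FreeGroup.of j)⁻¹}

/-- The braid group `B_n` (Artin's definition). -/
abbrev BraidGroup (n : ℕ) : Type := PresentedGroup (braidRelators n)

/-- The standard (Artin) generators of `B_n`. -/
def BraidGroup.gen {n : ℕ} (i : Fin (n - 1)) : BraidGroup n := PresentedGroup.of i

/-- `(H_1, …, H_{n-1})` is a system of frame generators of `B_n`, where `B_n` is realised as the
group `G`: the group `G` is generated by the `H_i`, and the commutative and triple relations are a
complete list of relations between them. In other words, `G` is identified with `B_n` in such a
way that the `H_i` are the Artin generators. -/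
def IsBraidFrame (n : ℕ) {G : Type*} [Group G] (H : Fin (n - 1) → G) : Prop :=
  ∃ e : BraidGroup n ≃* G, ∀ i, e (BraidGroup.gen i) = H i

/-- `s ∈ G^m` is obtained from `t ∈ G^m` by the Hurwitz move `R_k`
(positions `k` and `k + 1`, counted from `0`). -/
def HurwitzMove {G : Type*} [Group G] {m : ℕ} (k : ℕ) (hk : k + 1 < m) (t s : Fin m → G) : Prop :=
  s ⟨k, Nat.lt_of_succ_lt hk⟩ =
      t ⟨k, Nat.lt_of_succ_lt hk⟩ * t ⟨k + 1, hk⟩ * (t ⟨k, Nat.lt_of_succ_lt hk⟩)⁻¹ ∧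
  s ⟨k + 1, hk⟩ = t ⟨k, Nat.lt_of_succ_lt hk⟩ ∧
  ∀ i : Fin m, (i : ℕ) ≠ k → (i : ℕ) ≠ k + 1 → s i = t i

/-- Hurwitz equivalence of factorizations: `s` is obtained from `t` by a finite sequence of
Hurwitz moves `R_k` and inverse Hurwitz moves `R_k⁻¹`. -/
def HurwitzEquivalent {G : Type*} [Group G] {m : ℕ} (t s : Fin m → G) : Prop :=
  Relation.ReflTransGen
    (fun a b : Fin m → G =>
      ∃ (k : ℕ) (hk : k + 1 < m), HurwitzMove k hk a b ∨ HurwitzMove k hk b a) t s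

/-! Each Artin relation, applied inside a positive word, is a composite of Hurwitz moves: a
commuting pair is swapped by one move, and `(a, b, a)` becomes `(b, a, b)` after two. So it suffices
that positive words equal in the braid group are already linked by Artin relations between positive
words, with no inverses. This is Garside's embedding theorem,
`BraidMonoid.ofWord_eq_of_braidGroup_eq`.

For the embedding, the positive monoid is left cancellative, because any equality `a X = b Y`
factors through the least common multiple of `a` and `b` (`lcmFactorBelow`). The full twist is
central and divisible by every generator. Inverting it therefore embeds the monoid in one where all
generators are units, and the map to that monoid factors through the braid group. -/

/-- Artin's relations between positive words in `m` letters. -/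
inductive BraidMonoidRel (m : ℕ) : FreeMonoid (Fin m) → FreeMonoid (Fin m) → Prop
  | comm (i j : Fin m) (h : 1 < |(i : ℤ) - (j : ℤ)|) :
      BraidMonoidRel m (FreeMonoid.of i * FreeMonoid.of j) (FreeMonoid.of j * FreeMonoid.of i)
  | triple (i j : Fin m) (h : |(i : ℤ) - (j : ℤ)| = 1) :
      BraidMonoidRel m (FreeMonoid.of i * FreeMonoid.of j * FreeMonoid.of i)
        (FreeMonoid.of j * FreeMonoid.of i * FreeMonoid.of j)

/-- The monoid of positive braids with `m` Artin generators. -/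
abbrev BraidMonoid (m : ℕ) : Type := PresentedMonoid (BraidMonoidRel m)

/-! ### Least common multiples of generators and left cancellation in the positive braid monoid. -/

namespace BraidMonoid

variable {m : ℕ}

/-- The Artin generators of the positive braid monoid. -/
def gen (i : Fin m) : BraidMonoid m := PresentedMonoid.of _ i

/-- The positive braid represented by a word. -/
def ofWord : FreeMonoid (Fin m) →* BraidMonoid m := PresentedMonoid.mk _

@[simp] lemma ofWord_of (i : Fin m) : ofWord (FreeMonoid.of i) = gen i := rfl

lemma ofWord_surjective : Function.Surjective (ofWord (m := m)) := PresentedMonoid.surjective_mk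

lemma ofWord_eq_iff {u v : FreeMonoid (Fin m)} :
    ofWord u = ofWord v ↔ ConGen.Rel (BraidMonoidRel m) u v :=
  Con.eq _

lemma gen_comm {i j : Fin m} (h : 1 < |(i : ℤ) - (j : ℤ)|) : gen i * gen j = gen j * gen i :=
  ofWord_eq_iff.2 (.of _ _ (.comm i j h))

lemma gen_triple {i j : Fin m} (h : |(i : ℤ) - (j : ℤ)| = 1) :
    gen i * gen j * gen i = gen j * gen i * gen j :=
  ofWord_eq_iff.2 (.of _ _ (.triple i j h))

lemma gen_comm_mul {i j : Fin m} (h : 1 < |(i : ℤ) - (j : ℤ)|) (x : BraidMonoid m) :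
    gen i * (gen j * x) = gen j * (gen i * x) := by
  simp only [← mul_assoc, gen_comm h]

lemma gen_triple_mul {i j : Fin m} (h : |(i : ℤ) - (j : ℤ)| = 1) (x : BraidMonoid m) :
    gen i * (gen j * (gen i * x)) = gen j * (gen i * (gen j * x)) := by
  simp only [← mul_assoc, gen_triple h]

/-- The length of a positive braid. -/
def len : BraidMonoid m →* Multiplicative ℕ :=
  PresentedMonoid.lift (fun _ => Multiplicative.ofAdd 1) (by
    rintro _ _ (⟨i, j, -⟩ | ⟨i, j, -⟩) <;> simp)

@[simp] lemma toAdd_len_gen_mul (i : Fin m) (x : BraidMonoid m) :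
    (len (gen i * x)).toAdd = (len x).toAdd + 1 := by
  rw [map_mul, toAdd_mul, add_comm]; rfl

/-- The relation between `a, X` and `b, Y` which the equality `a X = b Y` forces: both sides are
multiples of the least common multiple of the generators `a` and `b`. -/
def LcmFactor (a : Fin m) (X : BraidMonoid m) (b : Fin m) (Y : BraidMonoid m) : Prop :=
  (a = b → X = Y) ∧
  (1 < |(a : ℤ) - (b : ℤ)| → ∃ Z, X = gen b * Z ∧ Y = gen a * Z) ∧
  (|(a : ℤ) - (b : ℤ)| = 1 → ∃ Z, X = gen b * (gen a * Z) ∧ Y = gen a * (gen b * Z))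

lemma LcmFactor.symm {a b : Fin m} {X Y : BraidMonoid m} (h : LcmFactor a X b Y) :
    LcmFactor b Y a X := by
  refine ⟨fun e => (h.1 e.symm).symm, fun e => ?_, fun e => ?_⟩
  · obtain ⟨Z, h₁, h₂⟩ := h.2.1 (by rwa [abs_sub_comm])
    exact ⟨Z, h₂, h₁⟩
  · obtain ⟨Z, h₁, h₂⟩ := h.2.2 (by rwa [abs_sub_comm])
    exact ⟨Z, h₂, h₁⟩

lemma LcmFactor.mul_right {a b : Fin m} {X Y : BraidMonoid m} (h : LcmFactor a X b Y)
    (Z : BraidMonoid m) : LcmFactor a (X * Z) b (Y * Z) := by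
  refine ⟨fun e => by rw [h.1 e], fun e => ?_, fun e => ?_⟩
  · obtain ⟨V, rfl, rfl⟩ := h.2.1 e
    exact ⟨V * Z, by simp only [mul_assoc], by simp only [mul_assoc]⟩
  · obtain ⟨V, rfl, rfl⟩ := h.2.2 e
    exact ⟨V * Z, by simp only [mul_assoc], by simp only [mul_assoc]⟩

lemma lcmFactor_of_eq {a : Fin m} {X Y : BraidMonoid m} (h : X = Y) : LcmFactor a X a Y :=
  ⟨fun _ => h, fun e => by simp at e, fun e => by simp at e⟩

lemma lcmFactor_of_far {a b : Fin m} (hab : 1 < |(a : ℤ) - (b : ℤ)|) (Z : BraidMonoid m) :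
    LcmFactor a (gen b * Z) b (gen a * Z) :=
  ⟨fun e => by simp [e] at hab, fun _ => ⟨Z, rfl, rfl⟩, fun e => by omega⟩

lemma lcmFactor_of_near {a b : Fin m} (hab : |(a : ℤ) - (b : ℤ)| = 1) (Z : BraidMonoid m) :
    LcmFactor a (gen b * (gen a * Z)) b (gen a * (gen b * Z)) :=
  ⟨fun e => by simp [e] at hab, fun e => by omega, fun _ => ⟨Z, rfl, rfl⟩⟩

lemma eq_or_far_or_near (a b : Fin m) :
    a = b ∨ 1 < |(a : ℤ) - (b : ℤ)| ∨ |(a : ℤ) - (b : ℤ)| = 1 := by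
  rcases eq_or_ne a b with h | h
  · exact .inl h
  · have : 0 < |(a : ℤ) - (b : ℤ)| := abs_pos.2 (by omega)
    omega

/-- All equalities `a X = b Y` with `X` of length less than `N` come from least common
multiples. -/
def LcmFactorBelow (m N : ℕ) : Prop :=
  ∀ (a b : Fin m) (X Y : BraidMonoid m), (len X).toAdd < N → gen a * X = gen b * Y →
    LcmFactor a X b Y

/-- The middle tail `W` starts with both `a` and `b`, which gives an equality one letter shorter,
where `ih` applies. Bounding the length of `W` keeps the hypotheses symmetric in the two ends. -/
lemma LcmFactor.trans_far_far {N : ℕ} (ih : LcmFactorBelow m N) {a c b : Fin m}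
    {X W Y : BraidMonoid m} (hW : (len W).toAdd ≤ N) (h₁ : LcmFactor a X c W)
    (h₂ : LcmFactor c W b Y) (hac : 1 < |(a : ℤ) - (c : ℤ)|) (hcb : 1 < |(c : ℤ) - (b : ℤ)|) :
    LcmFactor a X b Y := by
  obtain ⟨P, rfl, rfl⟩ := h₁.2.1 hac
  obtain ⟨Q, e, rfl⟩ := h₂.2.1 hcb
  rw [toAdd_len_gen_mul] at hW
  have h := ih a b P Q (by omega) e
  rcases eq_or_far_or_near a b with rfl | hab | hab
  · exact lcmFactor_of_eq (by rw [h.1 rfl])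
  · obtain ⟨V, rfl, rfl⟩ := h.2.1 hab
    rw [abs_sub_comm] at hac
    rw [gen_comm_mul hcb, gen_comm_mul hac]
    exact lcmFactor_of_far hab _
  · obtain ⟨V, rfl, rfl⟩ := h.2.2 hab
    rw [abs_sub_comm] at hac
    rw [gen_comm_mul hcb, gen_comm_mul hac, gen_comm_mul hac, gen_comm_mul hcb]
    exact lcmFactor_of_near hab _

lemma LcmFactor.trans_near_far {N : ℕ} (ih : LcmFactorBelow m N) {a c b : Fin m}
    {X W Y : BraidMonoid m} (hW : (len W).toAdd ≤ N) (h₁ : LcmFactor a X c W)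
    (h₂ : LcmFactor c W b Y) (hac : |(a : ℤ) - (c : ℤ)| = 1) (hcb : 1 < |(c : ℤ) - (b : ℤ)|) :
    LcmFactor a X b Y := by
  obtain ⟨P, rfl, rfl⟩ := h₁.2.2 hac
  obtain ⟨Q, e, rfl⟩ := h₂.2.1 hcb
  simp only [toAdd_len_gen_mul] at hW
  have h := ih a b _ Q (by rw [toAdd_len_gen_mul]; omega) e
  have hbc := abs_sub_comm (c : ℤ) b ▸ hcb
  rcases eq_or_far_or_near a b with rfl | hab | hab
  · omega
  · obtain ⟨V, e', rfl⟩ := h.2.1 hab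
    obtain ⟨U, rfl, rfl⟩ := (ih c b _ _ (by omega) e').2.1 hcb
    rw [gen_comm_mul hab, gen_comm_mul hcb, ← gen_triple_mul hac]
    exact lcmFactor_of_far hab _
  -- Now `c, a, b` are consecutive with `a` in the middle; `gen a * X` turns out to be the half
  -- twist on four strands times a remainder `T`.
  · obtain ⟨V, e', rfl⟩ := h.2.2 hab
    obtain ⟨U, rfl, e''⟩ := (ih c b _ _ (by omega) e').2.1 hcb
    have hl := congrArg (fun x => (len x).toAdd) e'
    simp only [toAdd_len_gen_mul] at hl hW
    obtain ⟨T, rfl, rfl⟩ := (ih a c _ _ (by omega) e'').2.2 hac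
    have hX : gen c * (gen a * (gen b * (gen a * (gen c * T)))) =
        gen b * (gen a * (gen c * (gen a * (gen b * T)))) := by
      rw [gen_triple_mul hab, gen_comm_mul hcb, gen_comm_mul hbc T, ← gen_triple_mul hac]
    have hY : gen c * (gen a * (gen b * (gen c * (gen a * T)))) =
        gen a * (gen b * (gen c * (gen a * (gen b * T)))) := by
      rw [gen_comm_mul hbc, ← gen_triple_mul hac, gen_triple_mul hab, gen_comm_mul hcb]
    rw [hX, hY]
    exact lcmFactor_of_near hab _

lemma LcmFactor.trans_near_near {N : ℕ} (ih : LcmFactorBelow m N) {a c b : Fin m}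
    {X W Y : BraidMonoid m} (hW : (len W).toAdd ≤ N) (h₁ : LcmFactor a X c W)
    (h₂ : LcmFactor c W b Y) (hac : |(a : ℤ) - (c : ℤ)| = 1) (hcb : |(c : ℤ) - (b : ℤ)| = 1) :
    LcmFactor a X b Y := by
  obtain ⟨P, rfl, rfl⟩ := h₁.2.2 hac
  obtain ⟨Q, e, rfl⟩ := h₂.2.2 hcb
  simp only [toAdd_len_gen_mul] at hW
  have h := ih a b _ _ (by rw [toAdd_len_gen_mul]; omega) e
  have hca := abs_sub_comm (a : ℤ) c ▸ hac
  rcases eq_or_far_or_near a b with rfl | hab | hab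
  -- For equal generators, `ih` is left cancellation of a letter from shorter elements.
  · have := (ih c c _ _ (by omega) (h.1 rfl)).1 rfl
    exact lcmFactor_of_eq (by rw [this])
  · obtain ⟨V, e₁, e₂⟩ := h.2.1 hab
    have hl₁ := congrArg (fun x => (len x).toAdd) e₁
    have hl₂ := congrArg (fun x => (len x).toAdd) e₂
    simp only [toAdd_len_gen_mul] at hl₁ hl₂
    obtain ⟨U, rfl, rfl⟩ := (ih c b _ _ (by omega) e₁).2.2 hcb
    obtain ⟨T, rfl, e₃⟩ := (ih c a _ _ (by omega) e₂).2.2 hca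
    simp only [toAdd_len_gen_mul] at hW
    have e₄ := (ih c c _ _ (by rw [toAdd_len_gen_mul]; omega) e₃).1 rfl
    obtain ⟨S, rfl, rfl⟩ := (ih b a _ _ (by omega) e₄).2.1 (abs_sub_comm (a : ℤ) b ▸ hab)
    have hX : gen c * (gen a * (gen b * (gen c * (gen a * S)))) =
        gen b * (gen c * (gen b * (gen a * (gen c * S)))) := by
      rw [gen_comm_mul hab, gen_triple_mul hac, gen_triple_mul hcb]
    have hY : gen c * (gen b * (gen a * (gen c * (gen b * S)))) =
        gen a * (gen c * (gen b * (gen a * (gen c * S)))) := by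
      rw [← gen_comm_mul hab, gen_triple_mul (abs_sub_comm (c : ℤ) b ▸ hcb),
        gen_triple_mul hca, gen_comm_mul hab]
    rw [hX, hY]
    exact lcmFactor_of_far hab _
  -- Three integers cannot be pairwise at distance one, by parity.
  · exfalso
    rcases abs_eq (zero_le_one (α := ℤ)) |>.1 hab with h | h <;>
    rcases abs_eq (zero_le_one (α := ℤ)) |>.1 hac with h' | h' <;>
    rcases abs_eq (zero_le_one (α := ℤ)) |>.1 hcb with h'' | h'' <;> omega

lemma LcmFactor.trans {N : ℕ} (ih : LcmFactorBelow m N) {a c b : Fin m}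
    {X W Y : BraidMonoid m} (hW : (len W).toAdd ≤ N) (h₁ : LcmFactor a X c W)
    (h₂ : LcmFactor c W b Y) : LcmFactor a X b Y := by
  rcases eq_or_far_or_near a c with rfl | hac | hac
  · rwa [h₁.1 rfl]
  · rcases eq_or_far_or_near c b with rfl | hcb | hcb
    · rwa [← h₂.1 rfl]
    · exact h₁.trans_far_far ih hW h₂ hac hcb
    · rw [abs_sub_comm] at hac hcb
      exact (h₂.symm.trans_near_far ih hW h₁.symm hcb hac).symm
  · rcases eq_or_far_or_near c b with rfl | hcb | hcb
    · rwa [← h₂.1 rfl]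
    · exact h₁.trans_near_far ih hW h₂ hac hcb
    · exact h₁.trans_near_near ih hW h₂ hac hcb

/-- Two words are both empty, or their first letters and tails satisfy `LcmFactor`. -/
def HeadCompatible (u v : FreeMonoid (Fin m)) : Prop :=
  (u = 1 ∧ v = 1) ∨ ∃ a b x y, u = FreeMonoid.of a * x ∧ v = FreeMonoid.of b * y ∧
    LcmFactor a (ofWord x) b (ofWord y)

/-- Induction on the generation of the congruence. Only transitivity needs `ih`: the middle word has
length at most `N + 1`, so its tail meets the bound in `LcmFactor.trans`. -/
lemma headCompatible_of_rel {N : ℕ} (ih : LcmFactorBelow m N) {u v : FreeMonoid (Fin m)}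
    (h : ConGen.Rel (BraidMonoidRel m) u v) (hu : (len (ofWord u)).toAdd ≤ N + 1) :
    HeadCompatible u v := by
  induction h with
  | of u v h =>
    obtain ⟨i, j, h⟩ | ⟨i, j, h⟩ := h
    · refine .inr ⟨i, j, _, _, rfl, rfl, ?_⟩
      simpa using lcmFactor_of_far h 1
    · refine .inr ⟨i, j, _, _, mul_assoc _ _ _, mul_assoc _ _ _, ?_⟩
      simpa using lcmFactor_of_near h 1
  | refl u =>
    induction u using FreeMonoid.casesOn with
    | one => exact .inl ⟨rfl, rfl⟩
    | of_mul a x => exact .inr ⟨a, a, x, x, rfl, rfl, lcmFactor_of_eq rfl⟩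
  | symm h ih' =>
    rw [← ofWord_eq_iff.2 h] at hu
    obtain ⟨rfl, rfl⟩ | ⟨a, b, x, y, rfl, rfl, h'⟩ := ih' hu
    · exact .inl ⟨rfl, rfl⟩
    · exact .inr ⟨b, a, y, x, rfl, rfl, h'.symm⟩
  | trans h₁ h₂ ih₁ ih₂ =>
    rw [← ofWord_eq_iff.2 h₁] at ih₂
    obtain ⟨rfl, rfl⟩ | ⟨a, c, x, w, rfl, rfl, h⟩ := ih₁ hu
    · exact ih₂ hu
    obtain ⟨h', -⟩ | ⟨c', b, w', y, e, rfl, h'⟩ := ih₂ hu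
    · simp at h'
    obtain ⟨rfl, rfl⟩ : c = c' ∧ w = w' := List.cons_eq_cons.1 e
    refine .inr ⟨a, b, x, y, rfl, rfl, h.trans ih ?_ h'⟩
    rw [ofWord_eq_iff.2 h₁, map_mul, ofWord_of, toAdd_len_gen_mul] at hu
    omega
  | @mul u₁ v₁ u₂ v₂ h₁ h₂ ih₁ ih₂ =>
    rw [map_mul, map_mul, toAdd_mul] at hu
    obtain ⟨rfl, rfl⟩ | ⟨a, b, x, y, rfl, rfl, h⟩ := ih₁ (by omega)
    · simpa using ih₂ (by omega)
    · refine .inr ⟨a, b, x * u₂, y * v₂, mul_assoc _ _ _, mul_assoc _ _ _, ?_⟩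
      rw [map_mul, map_mul, ofWord_eq_iff.2 h₂]
      exact h.mul_right _

lemma lcmFactorBelow (m N : ℕ) : LcmFactorBelow m N := by
  induction N with
  | zero => intro a b X Y h; omega
  | succ N ih =>
    intro a b X Y hX e
    obtain ⟨x, rfl⟩ := ofWord_surjective X
    obtain ⟨y, rfl⟩ := ofWord_surjective Y
    have hr : ConGen.Rel (BraidMonoidRel m) (FreeMonoid.of a * x) (FreeMonoid.of b * y) :=
      ofWord_eq_iff.1 (by simpa using e)
    obtain ⟨h, -⟩ | ⟨a', b', x', y', e₁, e₂, h⟩ := headCompatible_of_rel ih hr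
      (by rw [map_mul, ofWord_of, toAdd_len_gen_mul]; omega)
    · simp at h
    · obtain ⟨rfl, rfl⟩ : a = a' ∧ x = x' := List.cons_eq_cons.1 e₁
      obtain ⟨rfl, rfl⟩ : b = b' ∧ y = y' := List.cons_eq_cons.1 e₂
      exact h

instance : IsLeftCancelMul (BraidMonoid m) where
  mul_left_cancel x y z h := by
    obtain ⟨w, rfl⟩ := ofWord_surjective x
    induction w using FreeMonoid.inductionOn' with
    | one => simpa using h
    | of_mul a w ih =>
      refine ih ?_
      have h : ofWord (FreeMonoid.of a * w) * y = ofWord (FreeMonoid.of a * w) * z := h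
      rw [map_mul, mul_assoc, mul_assoc] at h
      exact (lcmFactorBelow m _ a a _ _ (Nat.lt_succ_self _) h).1 rfl

end BraidMonoid

/-! ### The product of all generators and its central power. -/

section Artin

variable {M : Type*} [Monoid M]

/-- The product `s 0 * s 1 * ⋯ * s (k - 1)`. -/
def initialProd (s : ℕ → M) : ℕ → M
  | 0 => 1
  | k + 1 => initialProd s k * s k

lemma initialProd_succ (s : ℕ → M) (k : ℕ) : initialProd s (k + 1) = initialProd s k * s k := rfl

lemma initialProd_succ_eq (s : ℕ → M) (k : ℕ) :
    initialProd s (k + 1) = s 0 * initialProd (fun i => s (i + 1)) k := by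
  induction k with
  | zero => simp [initialProd]
  | succ k ih => rw [initialProd, ih, mul_assoc]; rfl

variable {s : ℕ → M} {m : ℕ}

lemma mul_initialProd_of_le (hc : ∀ i j, i + 1 < j → s i * s j = s j * s i) {j k : ℕ}
    (hk : k < j) : s j * initialProd s k = initialProd s k * s j := by
  induction k with
  | zero => simp [initialProd]
  | succ k ih => rw [initialProd, ← mul_assoc, ih (by omega), mul_assoc, ← hc k j hk, mul_assoc]

/-- `s (i + 1)` passes the factors before `s i`, becomes `s i` on crossing `s i * s (i + 1)` by the
triple relation, then passes the rest. -/
lemma mul_initialProd_shift (hc : ∀ i j, i + 1 < j → s i * s j = s j * s i)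
    (ht : ∀ i, i + 1 < m → s i * s (i + 1) * s i = s (i + 1) * s i * s (i + 1)) {i k : ℕ}
    (hik : i + 2 ≤ k) (hkm : k ≤ m) :
    s (i + 1) * initialProd s k = initialProd s k * s i := by
  induction k, hik using Nat.le_induction with
  | base =>
    simp only [initialProd]
    rw [← mul_assoc, ← mul_assoc, mul_initialProd_of_le hc (by omega)]
    have := ht i (by omega)
    simp only [mul_assoc] at this ⊢
    rw [this]
  | succ k hk ih =>
    rw [initialProd, ← mul_assoc, ih (by omega), mul_assoc, hc i k hk, mul_assoc]

lemma initialProd_shift_mul (hc : ∀ i j, i + 1 < j → s i * s j = s j * s i)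
    (ht : ∀ i, i + 1 < m → s i * s (i + 1) * s i = s (i + 1) * s i * s (i + 1)) {k : ℕ}
    (hk : k < m) :
    initialProd (fun i => s (i + 1)) k * initialProd s m = initialProd s m * initialProd s k := by
  induction k with
  | zero => simp [initialProd]
  | succ k ih =>
    rw [initialProd, mul_assoc, mul_initialProd_shift hc ht hk le_rfl, ← mul_assoc,
      ih (by omega), mul_assoc, ← initialProd_succ]

/-- Closes the cycle of index shifts: passing one copy of the product lowers an index by one, and
passing two copies takes index `0` to the top index. -/
lemma zero_mul_initialProd_sq (hc : ∀ i j, i + 1 < j → s i * s j = s j * s i)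
    (ht : ∀ i, i + 1 < m + 1 → s i * s (i + 1) * s i = s (i + 1) * s i * s (i + 1)) :
    s 0 * initialProd s (m + 1) ^ 2 = initialProd s (m + 1) ^ 2 * s m := by
  have h : initialProd s (m + 1) ^ 2 = s 0 * initialProd s (m + 1) * initialProd s m := by
    rw [mul_assoc, ← initialProd_shift_mul hc ht (Nat.lt_succ_self m), ← mul_assoc,
      ← initialProd_succ_eq, sq]
  conv_rhs => rw [h, mul_assoc, ← initialProd_succ, mul_assoc, ← sq]

lemma mul_initialProd_pow (hc : ∀ i j, i + 1 < j → s i * s j = s j * s i)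
    (ht : ∀ i, i + 1 < m → s i * s (i + 1) * s i = s (i + 1) * s i * s (i + 1)) {i k : ℕ}
    (hik : i + k < m) : s (i + k) * initialProd s m ^ k = initialProd s m ^ k * s i := by
  induction k with
  | zero => simp
  | succ k ih =>
    rw [pow_succ', ← mul_assoc, ← add_assoc, mul_initialProd_shift hc ht (by omega) le_rfl,
      mul_assoc, ih (by omega), mul_assoc]

/-- The exponent counts the copies passed before `s i` returns to itself: `i` down to index `0`, two
to reach `m - 1`, and `m - 1 - i` back down to `i`. -/
lemma mul_initialProd_pow_succ (hc : ∀ i j, i + 1 < j → s i * s j = s j * s i)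
    (ht : ∀ i, i + 1 < m → s i * s (i + 1) * s i = s (i + 1) * s i * s (i + 1)) {i : ℕ}
    (hi : i < m) : s i * initialProd s m ^ (m + 1) = initialProd s m ^ (m + 1) * s i := by
  obtain ⟨k, rfl⟩ : ∃ k, m = i + k + 1 := ⟨m - 1 - i, by omega⟩
  have h₁ := mul_initialProd_pow hc ht (i := 0) (k := i) (by omega)
  have h₂ := zero_mul_initialProd_sq hc ht
  have h₃ := mul_initialProd_pow hc ht (i := i) (k := k) (by omega)
  rw [zero_add] at h₁
  rw [show i + k + 1 + 1 = i + 2 + k by omega, pow_add, pow_add, ← mul_assoc, ← mul_assoc, h₁,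
    mul_assoc (_ ^ i), h₂, mul_assoc, mul_assoc, h₃]
  simp only [mul_assoc]

/-- The `(i + 1)`-st power starts with `initialProd s m ^ i * s 0`, which equals `s i * initialProd
s m ^ i`. -/
lemma dvd_initialProd_pow_succ (hc : ∀ i j, i + 1 < j → s i * s j = s j * s i)
    (ht : ∀ i, i + 1 < m → s i * s (i + 1) * s i = s (i + 1) * s i * s (i + 1)) {i : ℕ}
    (hi : i < m) : s i ∣ initialProd s m ^ (m + 1) := by
  have h₁ := mul_initialProd_pow hc ht (i := 0) (k := i) (by omega)
  rw [zero_add] at h₁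
  obtain ⟨k, rfl⟩ : ∃ k, m = i + k + 1 := ⟨m - 1 - i, by omega⟩
  rw [show i + k + 1 + 1 = i + (k + 1 + 1) by omega, pow_add, pow_succ']
  rw [initialProd_succ_eq s (i + k)] at h₁ ⊢
  simp only [← mul_assoc] at h₁ ⊢
  rw [← h₁]
  simp only [mul_assoc]
  exact dvd_mul_right _ _

end Artin

/-! ### Inverting the full twist and Garside's embedding. -/

/-- Centrality makes the powers of `c` an Ore set; left cancellation makes the localization map
injective. -/
lemma exists_injective_isUnit_of_central.{u} {M : Type u} [Monoid M] [IsLeftCancelMul M] (c : M)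
    (hc : ∀ x, x * c = c * x) :
    ∃ (T : Type u) (_ : Monoid T) (f : M →* T), Function.Injective f ∧ IsUnit (f c) := by
  have hS : ∀ (x : M) (s : Submonoid.powers c), s * x = x * s := by
    rintro x ⟨_, k, rfl⟩
    exact ((show Commute c x from (hc x).symm).pow_left k)
  let _ : OreLocalization.OreSet (Submonoid.powers c) :=
    { ore_right_cancel := fun r₁ r₂ s h => ⟨s, by rwa [hS, hS]⟩
      oreNum := fun r _ => r
      oreDenom := fun _ s => s
      ore_eq := fun r s => hS r s }
  refine ⟨OreLocalization (Submonoid.powers c) M, inferInstance, OreLocalization.numeratorHom,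
    fun x y h => ?_, OreLocalization.numerator_isUnit ⟨c, Submonoid.mem_powers c⟩⟩
  obtain ⟨u, v, h₁, h₂⟩ := OreLocalization.oreDiv_eq_iff.1 h
  simp only [OneMemClass.coe_one, mul_one] at h₂
  subst h₂
  exact (mul_left_cancel h₁).symm

namespace BraidMonoid

variable {m : ℕ}

/-- The Artin generators indexed by `ℕ`, continued by `1`. -/
def genNat (m i : ℕ) : BraidMonoid m := if h : i < m then gen ⟨i, h⟩ else 1

lemma genNat_coe (i : Fin m) : genNat m i = gen i := by simp [genNat]

lemma genNat_comm (i j : ℕ) (h : i + 1 < j) :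
    genNat m i * genNat m j = genNat m j * genNat m i := by
  unfold genNat
  split_ifs
  · refine gen_comm ?_
    rw [abs_sub_comm]
    exact lt_abs.2 (.inl (by push_cast; omega))
  all_goals simp

lemma genNat_triple (i : ℕ) (h : i + 1 < m) :
    genNat m i * genNat m (i + 1) * genNat m i =
      genNat m (i + 1) * genNat m i * genNat m (i + 1) := by
  unfold genNat
  rw [dif_pos h, dif_pos (by omega)]
  exact gen_triple (by simp)

/-- The full twist, a central element divisible by all generators. -/
def fullTwist (m : ℕ) : BraidMonoid m := initialProd (genNat m) m ^ (m + 1)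

lemma mul_fullTwist (x : BraidMonoid m) : x * fullTwist m = fullTwist m * x := by
  obtain ⟨w, rfl⟩ := ofWord_surjective x
  induction w using FreeMonoid.inductionOn' with
  | one => simp
  | of_mul a w ih =>
    have := mul_initialProd_pow_succ genNat_comm genNat_triple a.2
    rw [genNat_coe] at this
    change ofWord (FreeMonoid.of a * w) * _ = _ * ofWord (FreeMonoid.of a * w)
    rw [map_mul, mul_assoc, ih, ← mul_assoc, ofWord_of, fullTwist, this, mul_assoc]

lemma gen_dvd_fullTwist (i : Fin m) : gen i ∣ fullTwist m :=
  genNat_coe i ▸ dvd_initialProd_pow_succ genNat_comm genNat_triple i.2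

end BraidMonoid

/-- Garside's embedding theorem: positive words which are equal in the braid group are equal in the
positive braid monoid. -/
theorem BraidMonoid.ofWord_eq_of_braidGroup_eq {n : ℕ} {u v : FreeMonoid (Fin (n - 1))}
    (h : FreeMonoid.lift (BraidGroup.gen (n := n)) u = FreeMonoid.lift BraidGroup.gen v) :
    ofWord u = ofWord v := by
  obtain ⟨T, _, f, hf, hu⟩ := exists_injective_isUnit_of_central (fullTwist (n - 1)) mul_fullTwist
  have hunit : ∀ i, IsUnit (f (gen i)) := by
    intro i
    obtain ⟨t, ht⟩ := gen_dvd_fullTwist i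
    -- Centrality and left cancellation turn the right cofactor `t` into a left one, so `f (gen i)`
    -- has inverses on both sides.
    have ht' : t * gen i = fullTwist (n - 1) := by
      refine mul_left_cancel (a := gen i) ?_
      rw [← mul_assoc, ← ht, mul_fullTwist]
    obtain ⟨w, hw⟩ := hu
    refine isUnit_iff_exists_and_exists.2 ⟨⟨f t * (w⁻¹ : Tˣ), ?_⟩, ⟨(w⁻¹ : Tˣ) * f t, ?_⟩⟩
    · rw [← mul_assoc, ← map_mul, ← ht, ← hw, Units.mul_inv]
    · rw [mul_assoc, ← map_mul, ht', ← hw, Units.inv_mul]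
  choose g hg using hunit
  have hrel : ∀ r ∈ braidRelators n, FreeGroup.lift g r = 1 := by
    rintro r (⟨i, j, hij, rfl⟩ | ⟨i, j, hij, rfl⟩)
    · rw [map_mul, map_inv, mul_inv_eq_one]
      ext
      simp only [map_mul, FreeGroup.lift_apply_of, Units.val_mul, hg]
      rw [← map_mul, ← map_mul, gen_comm hij]
    · rw [map_mul, map_inv, mul_inv_eq_one]
      ext
      simp only [map_mul, FreeGroup.lift_apply_of, Units.val_mul, hg]
      rw [← map_mul, ← map_mul, ← map_mul, ← map_mul, gen_triple hij]
  -- On positive words, `f ∘ ofWord` factors through the braid group; injectivity of `f` then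
  -- finishes.
  have key : ((Units.coeHom T).comp (PresentedGroup.toGroup hrel)).comp
      (FreeMonoid.lift (BraidGroup.gen (n := n))) = f.comp ofWord := by
    refine FreeMonoid.hom_eq fun i => ?_
    simp [BraidGroup.gen, hg]
  apply hf
  have := DFunLike.congr_fun key
  simp only [MonoidHom.comp_apply] at this
  rw [← this, ← this, h]

/-! ### Hurwitz moves on lists, and Artin relations as Hurwitz moves. -/

section Hurwitz

variable {G : Type*} [Group G]

/-- A Hurwitz move on factorizations written as lists. -/
inductive HurwitzStep : List G → List G → Prop
  | intro (l : List G) (a b : G) (r : List G) :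
      HurwitzStep (l ++ a :: b :: r) (l ++ (a * b * a⁻¹) :: a :: r)

lemma HurwitzStep.length_eq {u v : List G} (h : HurwitzStep u v) : u.length = v.length := by
  obtain ⟨l, a, b, r⟩ := h; simp

lemma HurwitzStep.append_append {u v : List G} (h : HurwitzStep u v) (x y : List G) :
    HurwitzStep (x ++ u ++ y) (x ++ v ++ y) := by
  obtain ⟨l, a, b, r⟩ := h
  simpa using HurwitzStep.intro (x ++ l) a b (r ++ y)

lemma eqvGen_hurwitzStep_append {u v u' v' : List G} (h : Relation.EqvGen HurwitzStep u v)
    (h' : Relation.EqvGen HurwitzStep u' v') :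
    Relation.EqvGen HurwitzStep (u ++ u') (v ++ v') := by
  have key : ∀ {p q : List G}, Relation.EqvGen HurwitzStep p q → ∀ x y,
      Relation.EqvGen HurwitzStep (x ++ p ++ y) (x ++ q ++ y) := by
    intro p q hpq x y
    induction hpq with
    | rel p q h => exact .rel _ _ (h.append_append x y)
    | refl p => exact .refl _
    | symm p q _ ih => exact ih.symm
    | trans p q r _ _ ih₁ ih₂ => exact ih₁.trans _ _ _ ih₂
  exact .trans _ _ _ (by simpa using key h [] u') (by simpa using key h' v [])

lemma HurwitzStep.hurwitzMove {u v : List G} (h : HurwitzStep u v) {p : ℕ} {t s : Fin p → G}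
    (ht : List.ofFn t = u) (hs : List.ofFn s = v) :
    ∃ (k : ℕ) (hk : k + 1 < p), HurwitzMove k hk t s := by
  obtain ⟨l, a, b, r⟩ := h
  have hp : p = (l ++ a :: b :: r).length := by rw [← ht, List.length_ofFn]
  have ht' : ∀ i : Fin p, (l ++ a :: b :: r)[(i : ℕ)]? = some (t i) := by
    intro i; rw [← ht]; simp
  have hs' : ∀ i : Fin p, (l ++ (a * b * a⁻¹) :: a :: r)[(i : ℕ)]? = some (s i) := by
    intro i; rw [← hs]; simp
  have hk : l.length + 1 < p := by simp at hp; omega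
  have t₀ := ht' ⟨l.length, by omega⟩
  have t₁ := ht' ⟨l.length + 1, hk⟩
  have s₀ := hs' ⟨l.length, by omega⟩
  have s₁ := hs' ⟨l.length + 1, hk⟩
  simp at t₀ t₁ s₀ s₁
  refine ⟨l.length, hk, ?_, ?_, fun i h₀ h₁ => ?_⟩
  · rw [← t₀, ← t₁, ← s₀]
  · rw [← t₀, ← s₁]
  · have e₁ := ht' i
    have e₂ := hs' i
    rcases lt_or_ge (i : ℕ) l.length with hi | hi
    · rw [List.getElem?_append_left hi] at e₁ e₂
      exact Option.some_injective _ (e₂.symm.trans e₁)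
    · rw [List.getElem?_append_right hi] at e₁ e₂
      obtain ⟨d, hd⟩ : ∃ d, (i : ℕ) - l.length = d + 2 := ⟨i - l.length - 2, by omega⟩
      rw [hd] at e₁ e₂
      exact Option.some_injective _ (e₂.symm.trans e₁)

lemma HurwitzEquivalent.symm {p : ℕ} {t s : Fin p → G} (h : HurwitzEquivalent t s) :
    HurwitzEquivalent s t := by
  refine Relation.ReflTransGen.mono ?_ _ _ (Relation.ReflTransGen.swap _ _ h)
  rintro a b ⟨k, hk, h⟩
  exact ⟨k, hk, h.symm⟩

lemma length_eq_of_eqvGen_hurwitzStep {u v : List G} (h : Relation.EqvGen HurwitzStep u v) :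
    u.length = v.length := by
  induction h with
  | rel p q h => exact h.length_eq
  | refl p => rfl
  | symm p q _ ih => exact ih.symm
  | trans p q r _ _ ih₁ ih₂ => exact ih₁.trans ih₂

lemma hurwitzEquivalent_of_eqvGen {u v : List G} (h : Relation.EqvGen HurwitzStep u v) :
    ∀ {p : ℕ} {t s : Fin p → G}, List.ofFn t = u → List.ofFn s = v → HurwitzEquivalent t s := by
  induction h with
  | rel u v h =>
    intro p t s ht hs
    obtain ⟨k, hk, h⟩ := h.hurwitzMove ht hs
    exact .single ⟨k, hk, .inl h⟩
  | refl u =>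
    intro p t s ht hs
    obtain rfl := List.ofFn_injective (ht.trans hs.symm)
    exact .refl
  | symm u v _ ih => exact fun ht hs => (ih hs ht).symm
  | trans u w v h₁ h₂ ih₁ ih₂ =>
    intro p t s ht hs
    -- Moves preserve length, so the intermediate list is again a `p`-tuple.
    have hp : w.length = p := by rw [← length_eq_of_eqvGen_hurwitzStep h₁, ← ht, List.length_ofFn]
    subst hp
    exact (ih₁ ht (List.ofFn_get w)).trans (ih₂ (List.ofFn_get w) hs)

lemma eqvGen_hurwitzStep_of_comm {a b : G} (h : a * b = b * a) :
    Relation.EqvGen HurwitzStep [a, b] [b, a] := by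
  have := HurwitzStep.intro [] a b []
  rw [h, mul_inv_cancel_right] at this
  exact .rel _ _ this

/-- The triple relation says `b * a * b⁻¹ = a⁻¹ * b * a`, so moving the last pair and then the first
gives `(a, b, a) → (a, a⁻¹ba, b) → (b, a, b)`. -/
lemma eqvGen_hurwitzStep_of_triple {a b : G} (h : a * b * a = b * a * b) :
    Relation.EqvGen HurwitzStep [a, b, a] [b, a, b] := by
  have h₁ := HurwitzStep.intro [a] (a⁻¹ * b * a) a []
  have h₂ := HurwitzStep.intro [] a (a⁻¹ * b * a) [b]
  have h₃ := HurwitzStep.intro [a] b a []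
  rw [show b * a * b⁻¹ = a⁻¹ * b * a by
    rw [mul_inv_eq_iff_eq_mul, mul_assoc, mul_assoc, eq_inv_mul_iff_mul_eq, ← mul_assoc, h,
      mul_assoc]] at h₃
  rw [show a * (a⁻¹ * b * a) * a⁻¹ = b by group] at h₂
  exact .trans _ _ _ (.rel _ _ h₃) (.rel _ _ h₂)

end Hurwitz

theorem proposition2p7 (n : ℕ) {G : Type*} [Group G] (H : Fin (n - 1) → G)
    (hH : IsBraidFrame n H) (p : ℕ) (i j : Fin p → Fin (n - 1))
    (hij : (List.ofFn fun k => H (i k)).prod = (List.ofFn fun k => H (j k)).prod) :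
    HurwitzEquivalent (fun k => H (i k)) (fun k => H (j k)) := by
  obtain ⟨e, he⟩ := hH
  have hword : ∀ l : Fin p → Fin (n - 1), e (FreeMonoid.lift (BraidGroup.gen (n := n))
      (FreeMonoid.ofList (List.ofFn l))) = (List.ofFn fun k => H (l k)).prod := by
    intro l
    rw [FreeMonoid.lift_ofList, map_list_prod, List.map_map, List.map_ofFn]
    congr 2
    funext k
    exact he (l k)
  -- Garside's theorem turns the equality in `G` into a derivation by positive relations, which
  -- `hlist` follows step by step.
  have hrel := BraidMonoid.ofWord_eq_iff.1 (BraidMonoid.ofWord_eq_of_braidGroup_eq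
    (e.injective ((hword i).trans (hij.trans (hword j).symm))))
  have hcomm : ∀ a b : Fin (n - 1), 1 < |(a : ℤ) - (b : ℤ)| → H a * H b = H b * H a := by
    intro a b hab
    rw [← he, ← he, ← map_mul, ← map_mul]
    exact congrArg e (mul_inv_eq_one.1 (PresentedGroup.one_of_mem (.inl ⟨a, b, hab, rfl⟩)))
  have htriple : ∀ a b : Fin (n - 1), |(a : ℤ) - (b : ℤ)| = 1 →
      H a * H b * H a = H b * H a * H b := by
    intro a b hab
    rw [← he, ← he, ← map_mul, ← map_mul, ← map_mul, ← map_mul]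
    exact congrArg e (mul_inv_eq_one.1 (PresentedGroup.one_of_mem (.inr ⟨a, b, hab, rfl⟩)))
  have hlist : ∀ u v : FreeMonoid (Fin (n - 1)), ConGen.Rel (BraidMonoidRel (n - 1)) u v →
      Relation.EqvGen HurwitzStep (u.toList.map H) (v.toList.map H) := by
    intro u v h
    induction h with
    | of u v h =>
      obtain ⟨a, b, h⟩ | ⟨a, b, h⟩ := h
      · exact eqvGen_hurwitzStep_of_comm (hcomm a b h)
      · exact eqvGen_hurwitzStep_of_triple (htriple a b h)
    | refl u => exact .refl _
    | symm _ ih => exact ih.symm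
    | trans _ _ ih₁ ih₂ => exact ih₁.trans _ _ _ ih₂
    | mul _ _ ih₁ ih₂ =>
      rw [FreeMonoid.toList_mul, FreeMonoid.toList_mul, List.map_append, List.map_append]
      exact eqvGen_hurwitzStep_append ih₁ ih₂
  exact hurwitzEquivalent_of_eqvGen (hlist _ _ hrel) (by simp [Function.comp_def])
    (by simp [Function.comp_def])
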